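/- There is a universal constant $C>0$ such that the following holds. Let $n\ge 1$, let $0<\kappa<\frac1n$, and let $\mu$ be a symmetric $\kappa$-concave Borel probability measure on $\mathbb{R}^n$ whose support is a convex body $K$ (a compact convex set with non-empty interior). Here symmetric means $\mu(-A)=\mu(A)$ for every Borel set $A$, and $\kappa$-concave means that $$\mu(\lambda A+(1-\lambda)B)\ \ge\ \bigl(\lambda\,\mu(A)^{\kappa}+(1-\lambda)\,\mu(B)^{\kappa}\bigr)^{1/\kappa}$$ for every $\lambda\in[0,1]$ and all Borel sets $A,B\subset\mathbb{R}^n$ with $\mu(A)\mu(B)>0$. Let $X_1,X_2,\ldots$ be i.i.d. random vectors with law $\mu$, let $K_N=\mathrm{conv}\{X_1,\ldots,X_N\}$, and write $|\cdot|$ for the volume. Then for every $\omega>C$ and every positive integer $N\ge e^{\frac1\kappa(\log n+2\log\omega)}$, $$\frac{\mathbb{E}|K_N|}{|K|}\ \ge\ 1-\frac1\omega .$$ -/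

import Mathlib

open MeasureTheory
open scoped Pointwise

/-- A convex body in `ℝⁿ`: a compact convex set with non-empty interior. -/
def IsConvexBody {n : ℕ} (K : Set (EuclideanSpace ℝ (Fin n))) : Prop :=
  IsCompact K ∧ Convex ℝ K ∧ (interior K).Nonempty

/-- A measure is symmetric if `μ (-A) = μ A` for all measurable `A`. -/
def IsSymmetricMeasure {n : ℕ} (μ : Measure (EuclideanSpace ℝ (Fin n))) : Prop :=
  ∀ A : Set (EuclideanSpace ℝ (Fin n)), MeasurableSet A → μ (-A) = μ A

/-- `κ`-concavity of a measure on `ℝⁿ`, for a parameter `κ > 0`: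
`μ (t A + (1 - t) B) ≥ (t μ(A)^κ + (1 - t) μ(B)^κ)^(1/κ)` for all `t ∈ [0, 1]` and all Borel sets
`A`, `B` of positive measure. As usual, the `κ`-mean on the right is read as `0` when one of the
two measures vanishes, so that there is no condition on such pairs. The set `t A + (1 - t) B` is
analytic, hence universally measurable, so the value of the outer measure there is its measure. -/
def IsKappaConcave {n : ℕ} (κ : ℝ) (μ : Measure (EuclideanSpace ℝ (Fin n))) : Prop :=
  ∀ t : ℝ, 0 ≤ t → t ≤ 1 → ∀ A B : Set (EuclideanSpace ℝ (Fin n)),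
    MeasurableSet A → MeasurableSet B → 0 < μ A → 0 < μ B →
      (ENNReal.ofReal t * μ A ^ κ + ENNReal.ofReal (1 - t) * μ B ^ κ) ^ (1 / κ) ≤
        μ (t • A + (1 - t) • B)

/-- The random polytope `K_N`: the convex hull of the first `N` points of a random sequence,
at the outcome `s`. -/
def randomPolytope {n : ℕ} {Ω : Type*} (X : ℕ → Ω → EuclideanSpace ℝ (Fin n)) (N : ℕ) (s : Ω) :
    Set (EuclideanSpace ℝ (Fin n)) :=
  convexHull ℝ ((fun i => X i s) '' Set.Iio N)

/-! Measure a functional `f` by its supremum of `|f|` on `K`. If a polytope inside `K` comes within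
`2δ` of the supporting hyperplane of every `g` in a `δ`-net of the unit sphere of this norm,
separation shows that it contains `(1 - 3δ)K` (`smul_subset_convexHull_of_net`). The net needs at
most `(1 + 2/δ)^n` functionals (`exists_finset_net_polar`).

Each cap `{g ≥ 1 - 2δ}` has mass at least `δ^(1/κ)/2` (`IsKappaConcave.le_measure_halfspace`), so
`N` samples all miss it with probability at most `exp(-N δ^(1/κ)/2)`. With `δ = 1/(6nω)`, the
assumed `N` gives `N δ^(1/κ) ≥ (ω/6)^(1/κ) ≥ (ω/6)^n`, which beats the size of the net in a union
bound (`net_card_mul_exp_le`). Failure and shrinking each cost at most `1/(2ω)`. -/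

/-! ### Nets of functionals -/

/-- Volume bound for the cardinality of a separated subset of the unit ball. -/
theorem card_le_of_separated_unitBall {E : Type*} [NormedAddCommGroup E] [NormedSpace ℝ E]
    [FiniteDimensional ℝ E] {η : ℝ} (hη : 0 < η) (s : Finset E) (hs : ∀ c ∈ s, ‖c‖ ≤ 1)
    (h : ∀ c ∈ s, ∀ d ∈ s, c ≠ d → η ≤ ‖c - d‖) :
    (s.card : ℝ) ≤ (1 + 2 / η) ^ Module.finrank ℝ E := by
  borelize E
  let μ : Measure E := Measure.addHaar
  have D : Set.Pairwise (s : Set E)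
      (Function.onFun Disjoint fun c => Metric.ball (c : E) (η / 2)) := by
    intro c hc d hd hcd
    apply Metric.ball_disjoint_ball
    rw [dist_eq_norm]
    linarith [h c hc d hd hcd]
  have hsub : (⋃ c ∈ s, Metric.ball (c : E) (η / 2)) ⊆ Metric.ball (0 : E) (1 + η / 2) := by
    refine Set.iUnion₂_subset fun x hx => Metric.ball_subset_ball' ?_
    rw [dist_zero_right]
    linarith [hs x hx]
  have I : (s.card : ENNReal) * ENNReal.ofReal ((η / 2) ^ Module.finrank ℝ E) *
      μ (Metric.ball 0 1) ≤
      ENNReal.ofReal ((1 + η / 2) ^ Module.finrank ℝ E) * μ (Metric.ball 0 1) := by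
    calc
      _ = μ (⋃ c ∈ s, Metric.ball (c : E) (η / 2)) := by
        rw [measure_biUnion_finset D fun c _ => measurableSet_ball]
        simp only [μ.addHaar_ball_of_pos _ (half_pos hη), Finset.sum_const, nsmul_eq_mul,
          mul_assoc]
      _ ≤ μ (Metric.ball (0 : E) (1 + η / 2)) := measure_mono hsub
      _ = _ := by rw [μ.addHaar_ball_of_pos _ (by positivity)]
  have J := (ENNReal.mul_le_mul_iff_left (Metric.measure_ball_pos _ _ zero_lt_one).ne'
    measure_ball_lt_top.ne).1 I
  have K := ENNReal.toReal_le_of_le_ofReal (by positivity) J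
  rw [ENNReal.toReal_mul, ENNReal.toReal_natCast, ENNReal.toReal_ofReal (by positivity),
    ← le_div_iff₀ (by positivity), ← div_pow] at K
  refine K.trans_eq (congrArg (· ^ _) ?_)
  field_simp
  ring

/-- Finite nets of controlled cardinality for subsets of the unit ball. -/
theorem exists_finset_net_unitBall {E : Type*} [NormedAddCommGroup E] [NormedSpace ℝ E]
    [FiniteDimensional ℝ E] {η : ℝ} (hη : 0 < η) (S : Set E) (hS : ∀ x ∈ S, ‖x‖ ≤ 1) :
    ∃ T : Finset E, (T : Set E) ⊆ S ∧ (T.card : ℝ) ≤ (1 + 2 / η) ^ Module.finrank ℝ E ∧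
      ∀ x ∈ S, ∃ y ∈ T, ‖x - y‖ ≤ η := by
  classical
  let p : Finset E → Prop := fun T =>
    (T : Set E) ⊆ S ∧ ∀ c ∈ T, ∀ d ∈ T, c ≠ d → η ≤ ‖c - d‖
  have hcard : ∀ T, p T → (T.card : ℝ) ≤ (1 + 2 / η) ^ Module.finrank ℝ E := fun T hT =>
    card_le_of_separated_unitBall hη T (fun c hc => hS c (hT.1 hc)) hT.2
  -- A separated subset of largest cardinality is a net: a point far from all of it could be added.
  let A : Set ℕ := {k | ∃ T, p T ∧ T.card = k}
  have hAne : A.Nonempty := ⟨0, ∅, by simp [p], rfl⟩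
  have hAb : BddAbove A := by
    refine ⟨⌈(1 + 2 / η) ^ Module.finrank ℝ E⌉₊, ?_⟩
    rintro k ⟨T, hT, rfl⟩
    exact_mod_cast (hcard T hT).trans (Nat.le_ceil _)
  obtain ⟨T, hT, hTA⟩ := Nat.sSup_mem hAne hAb
  refine ⟨T, hT.1, hcard T hT, fun x hx => ?_⟩
  by_contra! hcon
  have hxT : x ∉ T := fun hxT => by
    have := hcon x hxT
    simp only [sub_self, norm_zero] at this
    linarith
  have hp : p (insert x T) := by
    refine ⟨?_, ?_⟩
    · rw [Finset.coe_insert]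
      exact Set.insert_subset hx hT.1
    · intro c hc d hd hcd
      rcases Finset.mem_insert.1 hc with rfl | hc
      · rcases Finset.mem_insert.1 hd with rfl | hd
        · exact absurd rfl hcd
        · exact (hcon d hd).le
      · rcases Finset.mem_insert.1 hd with rfl | hd
        · rw [norm_sub_rev]
          exact (hcon c ‹_›).le
        · exact hT.2 c hc d hd hcd
  have := le_csSup hAb (show (insert x T).card ∈ A from ⟨_, hp, rfl⟩)
  rw [Finset.card_insert_of_notMem hxT, ← hTA] at this
  omega

/-- The boundary of the polar of a compact set has a small net for the norm `sup_K |f|`. -/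
theorem exists_finset_net_polar {E : Type*} [NormedAddCommGroup E] [NormedSpace ℝ E]
    [FiniteDimensional ℝ E] {K : Set E} (hK : IsCompact K) {η : ℝ} (hη : 0 < η) :
    ∃ T : Finset (StrongDual ℝ E), (T.card : ℝ) ≤ (1 + 2 / η) ^ Module.finrank ℝ E ∧
      (∀ f ∈ T, ∃ x ∈ K, |f x| = 1) ∧
      ∀ f : StrongDual ℝ E, (∀ x ∈ K, |f x| ≤ 1) → (∃ x ∈ K, |f x| = 1) →
        ∃ g ∈ T, ∀ x ∈ K, |f x - g x| ≤ η := by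
  classical
  have : CompactSpace K := isCompact_iff_compactSpace.1 hK
  -- Restriction to `K` may fail to be injective, so the net is built in its range, with the sup
  -- norm, and lifted back.
  let Φ : StrongDual ℝ E →ₗ[ℝ] C(K, ℝ) :=
    { toFun := fun f => ⟨fun x => f x, by fun_prop⟩
      map_add' := fun f g => by ext; simp
      map_smul' := fun c f => by ext; simp }
  have hΦ : ∀ f x, Φ f x = f x := fun f x => rfl
  let S : Set (LinearMap.range Φ) := {u | ‖u‖ ≤ 1 ∧ ∃ x, |(u : C(K, ℝ)) x| = 1}
  obtain ⟨T, hTS, hTc, hT⟩ := exists_finset_net_unitBall hη S fun u hu => hu.1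
  choose r hr using fun u : LinearMap.range Φ => u.2
  have hfin : Module.finrank ℝ (LinearMap.range Φ) ≤ Module.finrank ℝ E := by
    refine (LinearMap.finrank_range_le Φ).trans_eq ?_
    rw [← (LinearMap.toContinuousLinearMap (𝕜 := ℝ) (E := E) (F' := ℝ)).finrank_eq]
    exact Subspace.dual_finrank_eq
  refine ⟨T.image r, ?_, ?_, ?_⟩
  · calc ((T.image r).card : ℝ) ≤ T.card := by exact_mod_cast Finset.card_image_le
      _ ≤ _ := hTc
      _ ≤ _ := pow_le_pow_right₀ (by linarith [div_pos two_pos hη]) hfin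
  · intro f hf
    obtain ⟨u, hu, rfl⟩ := Finset.mem_image.1 hf
    obtain ⟨x, hx⟩ := (hTS hu).2
    refine ⟨x, x.2, ?_⟩
    rw [← hΦ, hr, hx]
  · rintro f hf1 ⟨x, hx, hfx⟩
    have hfS : ‖Φ f‖ ≤ 1 := (ContinuousMap.norm_le _ zero_le_one).2 fun y => hf1 y y.2
    obtain ⟨u, hu, hfu⟩ := hT ⟨Φ f, f, rfl⟩ ⟨hfS, ⟨x, hx⟩, hfx⟩
    refine ⟨r u, Finset.mem_image_of_mem _ hu, fun y hy => ?_⟩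
    have := (ContinuousMap.norm_coe_le_norm (Φ f - u : C(K, ℝ)) ⟨y, hy⟩).trans hfu
    rwa [← hr, ContinuousMap.sub_apply, hΦ, hΦ, Real.norm_eq_abs] at this

/-! ### Mass of caps and missed caps -/

/-- Half-spaces of a symmetric `κ`-concave measure meeting a smaller copy of the support have
mass bounded below. -/
theorem IsKappaConcave.le_measure_halfspace {n : ℕ} {κ : ℝ} (hκ : 0 < κ)
    {μ : Measure (EuclideanSpace ℝ (Fin n))} [IsProbabilityMeasure μ]
    (hs : IsSymmetricMeasure μ) (hc : IsKappaConcave κ μ) {x : EuclideanSpace ℝ (Fin n)}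
    (hx : x ∈ μ.support) (f : StrongDual ℝ (EuclideanSpace ℝ (Fin n))) (hfx : f x = 1)
    {δ : ℝ} (h0 : 0 < δ) (h1 : δ < 1) :
    δ ^ (1 / κ) / 2 ≤ μ.real {y | 1 - 2 * δ ≤ f y} := by
  set A : Set (EuclideanSpace ℝ (Fin n)) := {y | 1 - δ < f y} with hA
  set B : Set (EuclideanSpace ℝ (Fin n)) := {y | 0 ≤ f y} with hB
  have hAo : IsOpen A := isOpen_lt continuous_const f.continuous
  have hBm : MeasurableSet B := (isClosed_le continuous_const f.continuous).measurableSet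
  have hApos : 0 < μ A :=
    Measure.mem_support_iff_forall x |>.1 hx A (hAo.mem_nhds (by simp [hA, hfx, h0]))
  have hBhalf : 1 / 2 ≤ μ.real B := by
    have hneg : μ.real (-B) = μ.real B := by simp [Measure.real, hs B hBm]
    have hun : B ∪ -B = Set.univ := by
      ext y
      simpa [hB] using le_total 0 (f y)
    have := measureReal_union_le (μ := μ) B (-B)
    rw [hun, probReal_univ, hneg] at this
    linarith
  have hBpos : 0 < μ B := (ENNReal.toReal_pos_iff.1 (show 0 < μ.real B by linarith)).1
  -- On the left `f` exceeds `(1 - δ)² ≥ 1 - 2δ`.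
  have hsub : (1 - δ) • A + (1 - (1 - δ)) • B ⊆ {y | 1 - 2 * δ ≤ f y} := by
    rintro _ ⟨_, ⟨a, ha, rfl⟩, _, ⟨b, hb, rfl⟩, rfl⟩
    simp only [hA, hB, Set.mem_ofPred_eq] at ha hb ⊢
    simp only [map_add, map_smul, smul_eq_mul]
    nlinarith [mul_nonneg h0.le hb]
  have key := (hc (1 - δ) (by linarith) (by linarith) A B hAo.measurableSet hBm hApos hBpos).trans
    (measure_mono hsub)
  -- The term of `A` is dropped: only the positivity of `μ A` matters, not its size.
  have h2 : ENNReal.ofReal (δ ^ (1 / κ)) * μ B ≤ μ {y | 1 - 2 * δ ≤ f y} := by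
    refine le_trans ?_ key
    calc ENNReal.ofReal (δ ^ (1 / κ)) * μ B
        = (ENNReal.ofReal (1 - (1 - δ)) * μ B ^ κ) ^ (1 / κ) := by
          rw [ENNReal.mul_rpow_of_nonneg _ _ (by positivity), ← ENNReal.rpow_mul,
            mul_one_div_cancel hκ.ne', ENNReal.rpow_one, sub_sub_cancel,
            ENNReal.ofReal_rpow_of_pos h0]
      _ ≤ _ := ENNReal.rpow_le_rpow le_add_self (by positivity)
  have h3 := ENNReal.toReal_mono (measure_ne_top _ _) h2
  rw [ENNReal.toReal_mul, ENNReal.toReal_ofReal (by positivity)] at h3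
  calc δ ^ (1 / κ) / 2 = δ ^ (1 / κ) * (1 / 2) := by ring
    _ ≤ δ ^ (1 / κ) * μ.real B := by gcongr
    _ ≤ _ := h3

/-- An i.i.d. sample misses a set of mass at least `q` with exponentially small probability. -/
theorem measureReal_forall_lt_notMem_le {Ω E : Type*} [MeasurableSpace Ω] [MeasurableSpace E]
    {P : Measure Ω} [IsProbabilityMeasure P] {μ : Measure E} [IsProbabilityMeasure μ]
    {X : ℕ → Ω → E} (hX : ∀ i, Measurable (X i)) (hind : ProbabilityTheory.iIndepFun X P)
    (hmap : ∀ i, P.map (X i) = μ) {H : Set E} (hH : MeasurableSet H) {q : ℝ}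
    (hq : q ≤ μ.real H) (N : ℕ) :
    P.real {s | ∀ i < N, X i s ∉ H} ≤ Real.exp (-(N * q)) := by
  have hset : {s | ∀ i < N, X i s ∉ H} = ⋂ i ∈ Finset.range N, X i ⁻¹' Hᶜ := by
    ext s
    simp
  have hprod : P {s | ∀ i < N, X i s ∉ H} = μ Hᶜ ^ N := by
    rw [hset, hind.measure_inter_preimage_eq_mul (Finset.range N) fun i _ => hH.compl]
    simp_rw [← Measure.map_apply (hX _) hH.compl, hmap]
    simp
  rw [Measure.real, hprod, ENNReal.toReal_pow]
  change μ.real Hᶜ ^ N ≤ _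
  rw [probReal_compl_eq_one_sub hH]
  calc (1 - μ.real H) ^ N ≤ Real.exp (-q) ^ N := by
        refine pow_le_pow_left₀ (by linarith [measureReal_le_one (μ := μ) (s := H)]) ?_ _
        linarith [Real.one_sub_le_exp_neg q]
    _ = Real.exp (-(N * q)) := by rw [← Real.exp_nat_mul]; ring_nf

/-! ### From the net to inclusion; measurability of the volume -/

/-- If `X₁, …, X_N ∈ K` nearly reach the supporting hyperplanes of `K` in all
directions of a net, then their convex hull contains a slightly shrunk copy of `K`. -/
theorem smul_subset_convexHull_of_net {E : Type*} [NormedAddCommGroup E] [NormedSpace ℝ E]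
    {K : Set E} (hK : IsCompact K) {T : Set (StrongDual ℝ E)} {δ : ℝ}
    (hδ : 3 * δ ≤ 1)
    (hT : ∀ f : StrongDual ℝ E, (∀ x ∈ K, |f x| ≤ 1) → (∃ x ∈ K, |f x| = 1) →
        ∃ g ∈ T, ∀ x ∈ K, |f x - g x| ≤ δ)
    {V : Set E} (hVf : V.Finite) (hVn : V.Nonempty) (hVK : V ⊆ K)
    (hV : ∀ g ∈ T, ∃ x ∈ V, 1 - 2 * δ ≤ g x) :
    (1 - 3 * δ) • K ⊆ convexHull ℝ V := by
  rintro _ ⟨y, hy, rfl⟩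
  by_contra hcon
  obtain ⟨f, u, hfV, hfy⟩ := geometric_hahn_banach_closed_point (convex_convexHull ℝ V)
    (hVf.isClosed_convexHull ℝ) hcon
  have hfV' : ∀ v ∈ V, f v < (1 - 3 * δ) * f y := fun v hv => by
    have := (hfV v (subset_convexHull ℝ V hv)).trans hfy
    simpa using this
  obtain ⟨z, hz, hzmax⟩ := hK.exists_isMaxOn ⟨y, hy⟩ (f := fun x => |f x|) (by fun_prop)
  have hzmax' : ∀ x ∈ K, |f x| ≤ |f z| := fun x hx => hzmax hx
  -- If `f` vanished on `K`, the strict separation would read `0 < 0`.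
  have hpos : 0 < |f z| := by
    by_contra h0
    obtain ⟨v, hv⟩ := hVn
    have e : ∀ x ∈ K, f x = 0 := fun x hx =>
      abs_eq_zero.1 (le_antisymm ((hzmax' x hx).trans (not_lt.1 h0)) (abs_nonneg _))
    have := hfV' v hv
    rw [e v (hVK hv), e y hy] at this
    simp at this
  have hab : ∀ x, |(|f z|⁻¹ • f) x| = |f x| / |f z| := fun x => by
    simp [abs_mul, abs_inv, div_eq_inv_mul]
  obtain ⟨g, hg, hfg⟩ := hT (|f z|⁻¹ • f)
    (fun x hx => by rw [hab, div_le_one hpos]; exact hzmax' x hx)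
    ⟨z, hz, by rw [hab, div_self hpos.ne']⟩
  obtain ⟨v, hv, hgv⟩ := hV g hg
  have h1 := (abs_le.1 (hfg v (hVK hv))).1
  have h2 : 1 - 3 * δ ≤ |f z|⁻¹ * f v := by
    have : (|f z|⁻¹ • f) v = |f z|⁻¹ * f v := rfl
    linarith
  have h3 : (1 - 3 * δ) * |f z| ≤ f v := by
    rw [inv_mul_eq_div, le_div_iff₀ hpos] at h2
    exact h2
  have h4 : (1 - 3 * δ) * f y ≤ (1 - 3 * δ) * |f z| :=
    mul_le_mul_of_nonneg_left ((le_abs_self _).trans (hzmax' y hy)) (by linarith)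
  linarith [hfV' v hv]

/-- The volume of the convex hull of finitely many points depends measurably on the points. -/
theorem measurable_measure_convexHull_range {E : Type*} [NormedAddCommGroup E] [NormedSpace ℝ E]
    [FiniteDimensional ℝ E] [MeasurableSpace E] [BorelSpace E] (ν : Measure E) [SFinite ν]
    (ι : Type*) [Fintype ι] :
    Measurable fun x : ι → E => ν (convexHull ℝ (Set.range x)) := by
  have : SecondCountableTopology E := by
    have := FiniteDimensional.proper ℝ E
    infer_instance
  let G : Set ((ι → E) × E) := {p | p.2 ∈ convexHull ℝ (Set.range p.1)}
  -- `G` is the projection of a closed set along the compact simplex of weights.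
  have hG : IsClosed G := by
    have : CompactSpace (stdSimplex ℝ ι) := isCompact_iff_compactSpace.1 (isCompact_stdSimplex ℝ ι)
    let Z : Set (stdSimplex ℝ ι × ((ι → E) × E)) := {q | ∑ i, q.1.1 i • q.2.1 i = q.2.2}
    have hZ : IsClosed Z := isClosed_eq
      (continuous_finsetSum _ fun i _ =>
        ((continuous_apply i).comp (continuous_subtype_val.comp continuous_fst)).smul
          ((continuous_apply i).comp (continuous_fst.comp continuous_snd)))
      (continuous_snd.comp continuous_snd)
    have himg : ∀ x : ι → E, convexHull ℝ (Set.range x) =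
        Fintype.linearCombination ℝ x '' stdSimplex ℝ ι := fun x => by
      classical
      rw [← convexHull_basis_eq_stdSimplex, LinearMap.image_convexHull, ← Set.range_comp]
      congr 2
      ext i
      simp [Fintype.linearCombination_apply]
    convert isClosedMap_snd_of_compactSpace Z hZ
    ext ⟨x, y⟩
    simp [G, Z, himg, Fintype.linearCombination_apply]
  exact measurable_measure_prodMk_left hG.measurableSet

/-- The logarithm of the left side is at most `4n(n + 1)√u`, and `u ≥ 100√u` lets `u ^ n / 2`
dominate it. The exponent `n + 1` leaves one factor beyond the net size to absorb `2ω`. -/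
theorem pow_succ_le_exp_pow_div_two {n : ℕ} (hn : 1 ≤ n) {u : ℝ} (hu : 10000 ≤ u) :
    (78 * n * u) ^ (n + 1) ≤ Real.exp (u ^ n / 2) := by
  obtain ⟨k, rfl⟩ : ∃ k, n = k + 1 := ⟨n - 1, by omega⟩
  set v := √u with hv
  have hvu : v ^ 2 = u := Real.sq_sqrt (by linarith)
  have hv100 : 100 ≤ v := Real.le_sqrt_of_sq_le (by linarith)
  have hn1 : (1 : ℝ) ≤ ((k + 1 : ℕ) : ℝ) := by exact_mod_cast hn
  have hlog : Real.log (78 * ((k + 1 : ℕ) : ℝ) * u) ≤ ((k + 1 : ℕ) : ℝ) * (4 * v) := by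
    rw [← hvu, Real.log_mul (by positivity) (by positivity),
      Real.log_mul (by norm_num) (by positivity), Real.log_pow]
    have h1 := Real.log_le_sub_one_of_pos (show (0 : ℝ) < 78 by norm_num)
    have h2 := Real.log_le_sub_one_of_pos (show (0 : ℝ) < ((k + 1 : ℕ) : ℝ) by linarith)
    have h3 := Real.log_le_sub_one_of_pos (show (0 : ℝ) < v by linarith)
    push_cast at *
    nlinarith
  have hpow : 8 * ((k : ℝ) + 1) * (k + 2) ≤ 100 * 10000 ^ k := by
    have h1 : (k : ℝ) + 1 ≤ 2 ^ k := by exact_mod_cast Nat.lt_two_pow_self (n := k)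
    have h2 : (k : ℝ) + 2 ≤ 2 * 2 ^ k := by
      linarith [one_le_pow₀ (show (1 : ℝ) ≤ 2 by norm_num) (n := k)]
    calc 8 * ((k : ℝ) + 1) * (k + 2) ≤ 8 * 2 ^ k * (2 * 2 ^ k) := by gcongr
      _ = 16 * 4 ^ k := by
        rw [show (4 : ℝ) = 2 * 2 by norm_num, mul_pow]; ring
      _ ≤ 100 * 10000 ^ k := by gcongr <;> norm_num
  have hlow : 100 * v * 10000 ^ k ≤ u ^ (k + 1) := by
    rw [pow_succ, mul_comm]
    have : 100 * v ≤ u := by nlinarith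
    gcongr
  have hpos : 0 < 78 * ((k + 1 : ℕ) : ℝ) * u := by positivity
  rw [← Real.exp_log hpos, ← Real.exp_nat_mul, Real.exp_le_exp]
  calc ((k + 1 + 1 : ℕ) : ℝ) * Real.log (78 * ((k + 1 : ℕ) : ℝ) * u)
      ≤ ((k + 1 + 1 : ℕ) : ℝ) * (((k + 1 : ℕ) : ℝ) * (4 * v)) := by gcongr
    _ = (8 * ((k : ℝ) + 1) * (k + 2)) * v / 2 := by push_cast; ring
    _ ≤ (100 * 10000 ^ k) * v / 2 := by gcongr
    _ ≤ u ^ (k + 1) / 2 := by linarith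

/-- The size of a `1 / (6nω)`-net times the exponential failure probability is small. -/
theorem net_card_mul_exp_le {n : ℕ} (hn : 1 ≤ n) {m : ℝ} (hm : n ≤ m) {ω : ℝ} (hω : 60000 < ω)
    {N : ℝ} (hN : Real.exp (m * (Real.log n + 2 * Real.log ω)) ≤ N) :
    (1 + 2 / (1 / (6 * n * ω))) ^ n * Real.exp (-(N * ((1 / (6 * n * ω)) ^ m / 2))) ≤
      1 / (2 * ω) := by
  have hn1 : (1 : ℝ) ≤ n := by exact_mod_cast hn
  have hω0 : 0 < ω := by linarith
  set u := ω / 6 with hu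
  have hu4 : 10000 ≤ u := by linarith
  have hN' : ((n : ℝ) * ω ^ 2) ^ m ≤ N := by
    rw [Real.rpow_def_of_pos (by positivity), Real.log_mul (by positivity) (by positivity),
      Real.log_pow, mul_comm]
    exact hN
  have hNδ : u ^ n ≤ N * (1 / (6 * n * ω)) ^ m := by
    calc u ^ n = u ^ (n : ℝ) := (Real.rpow_natCast u n).symm
      _ ≤ u ^ m := Real.rpow_le_rpow_of_exponent_le (by linarith) hm
      _ = ((n : ℝ) * ω ^ 2) ^ m * (1 / (6 * n * ω)) ^ m := by
        rw [← Real.mul_rpow (by positivity) (by positivity), hu]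
        congr 1
        field_simp
      _ ≤ _ := by gcongr
  have hnu : 10000 ≤ n * u := by nlinarith
  have hbase : 1 + 2 / (1 / (6 * n * ω)) ≤ 78 * n * u := by
    have : 2 / (1 / (6 * n * ω)) = 72 * n * u := by rw [hu]; field_simp; norm_num
    rw [this]
    linarith
  have hlin : 2 * ω ≤ 78 * n * u := by nlinarith
  rw [le_div_iff₀ (by positivity)]
  calc _ ≤ (78 * n * u) ^ n * Real.exp (-(u ^ n / 2)) * (78 * n * u) := by
        gcongr
        linarith
    _ = (78 * n * u) ^ (n + 1) * Real.exp (-(u ^ n / 2)) := by ring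
    _ ≤ Real.exp (u ^ n / 2) * Real.exp (-(u ^ n / 2)) := by
        gcongr
        exact pow_succ_le_exp_pow_div_two hn hu4
    _ = 1 := by rw [← Real.exp_add, add_neg_cancel, Real.exp_zero]

/-- The support of a symmetric measure is symmetric. -/
theorem IsSymmetricMeasure.neg_mem_support {n : ℕ} {μ : Measure (EuclideanSpace ℝ (Fin n))}
    (hs : IsSymmetricMeasure μ) {x : EuclideanSpace ℝ (Fin n)} (hx : x ∈ μ.support) :
    -x ∈ μ.support := by
  rw [Measure.mem_support_iff_forall] at hx ⊢
  intro U hU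
  obtain ⟨V, hVU, hV, hxV⟩ := mem_nhds_iff.1 hU
  refine lt_of_lt_of_le ?_ (measure_mono hVU)
  rw [← hs V hV.measurableSet]
  exact hx _ (hV.neg.mem_nhds hxV)

theorem measurable_volume_randomPolytope {n : ℕ} {Ω : Type*} [MeasurableSpace Ω]
    {X : ℕ → Ω → EuclideanSpace ℝ (Fin n)} (hX : ∀ i, Measurable (X i)) (N : ℕ) :
    Measurable fun s => volume (randomPolytope X N s) := by
  have h : ∀ s, randomPolytope X N s =
      convexHull ℝ (Set.range fun i : Fin N => X i s) := fun s => by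
    rw [randomPolytope]
    congr 1
    ext y
    simp [Fin.exists_iff]
  simp_rw [h]
  exact (measurable_measure_convexHull_range volume (Fin N)).comp
    (measurable_pi_lambda _ fun i => hX i)

/-- A random polytope from a symmetric `κ`-concave law on `K` with at least `(n ω²)^(1/κ)` vertices
fills a proportion `1 - 1/ω` of the volume of `K` in expectation. -/
theorem theorem2 :
    ∃ C : ℝ, 0 < C ∧
      ∀ (n : ℕ), 1 ≤ n →
      ∀ (κ : ℝ), 0 < κ → κ < 1 / (n : ℝ) →
      ∀ (K : Set (EuclideanSpace ℝ (Fin n))), IsConvexBody K →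
      ∀ (μ : Measure (EuclideanSpace ℝ (Fin n))) [IsProbabilityMeasure μ],
        IsSymmetricMeasure μ → IsKappaConcave κ μ → μ.support = K →
      ∀ (Ω : Type*) [MeasurableSpace Ω] (P : Measure Ω) [IsProbabilityMeasure P]
        (X : ℕ → Ω → EuclideanSpace ℝ (Fin n)),
        (∀ i, Measurable (X i)) → ProbabilityTheory.iIndepFun X P → (∀ i, P.map (X i) = μ) →
      ∀ (ω : ℝ), C < ω →
      ∀ (N : ℕ), Real.exp ((1 / κ) * (Real.log n + 2 * Real.log ω)) ≤ (N : ℝ) →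
        Integrable (fun s => volume.real (randomPolytope X N s)) P ∧
          1 - 1 / ω ≤ (∫ s, volume.real (randomPolytope X N s) ∂P) / volume.real K := by
  -- This makes `ω/6 ≥ 10000`, as the numerical estimate requires.
  refine ⟨60000, by norm_num, ?_⟩
  intro n hn κ hκ hκn K hK μ _ hs hc hsupp Ω _ P _ X hX hind hmap ω hω N hN
  obtain ⟨hKc, hKconv, hKint⟩ := hK
  have hn1 : (1 : ℝ) ≤ n := by exact_mod_cast hn
  have hω0 : 0 < ω := by linarith
  have hKs : ∀ x ∈ K, -x ∈ K := fun x hx => by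
    rw [← hsupp] at hx ⊢
    exact hs.neg_mem_support hx
  have hvol : 0 < volume.real K :=
    ENNReal.toReal_pos (Measure.measure_pos_of_nonempty_interior _ hKint).ne' hKc.measure_lt_top.ne
  have hXK : ∀ᵐ s ∂P, ∀ i, X i s ∈ K := by
    refine ae_all_iff.2 fun i => ae_of_ae_map (hX i).aemeasurable ?_
    rw [hmap, ← hsupp]
    exact Measure.support_mem_ae
  have hsub : ∀ s, (∀ i, X i s ∈ K) → randomPolytope X N s ⊆ K := fun s h =>
    convexHull_min (by rintro _ ⟨i, -, rfl⟩; exact h i) hKconv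
  have hint : Integrable (fun s => volume.real (randomPolytope X N s)) P := by
    refine Integrable.of_bound
      (measurable_volume_randomPolytope hX N).ennreal_toReal.aestronglyMeasurable
      (volume.real K) ?_
    filter_upwards [hXK] with s h
    rw [Real.norm_of_nonneg measureReal_nonneg]
    exact measureReal_mono (hsub s h) hKc.measure_lt_top.ne
  refine ⟨hint, ?_⟩
  have hm : (n : ℝ) ≤ 1 / κ := by
    rw [lt_div_iff₀ (by linarith)] at hκn
    rw [le_div_iff₀ hκ]
    linarith
  have hN0 : 0 < N := by exact_mod_cast (Real.exp_pos _).trans_le hN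
  -- Chosen so that Bernoulli's inequality loses exactly `3δn = 1/(2ω)` in volume.
  set δ : ℝ := 1 / (6 * n * ω) with hδ
  have hδ0 : 0 < δ := by positivity
  have hδn : 3 * δ * n = 1 / (2 * ω) := by rw [hδ]; field_simp; norm_num
  have hω2 : 1 / (2 * ω) ≤ 1 / 2 := by
    gcongr
    linarith
  have hδ1 : 3 * δ ≤ 1 / 2 := by nlinarith
  obtain ⟨T, hTc, hT1, hT⟩ := exists_finset_net_polar hKc hδ0
  rw [finrank_euclideanSpace_fin] at hTc
  let H : StrongDual ℝ (EuclideanSpace ℝ (Fin n)) → Set (EuclideanSpace ℝ (Fin n)) :=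
    fun g => {y | 1 - 2 * δ ≤ g y}
  have hH : ∀ g, MeasurableSet (H g) := fun g =>
    (isClosed_le continuous_const g.continuous).measurableSet
  let bad : Set Ω := ⋃ g ∈ T, {s | ∀ i < N, X i s ∉ H g}
  have hbadm : MeasurableSet bad := by
    refine Finset.measurableSet_biUnion _ fun g _ => ?_
    have : {s | ∀ i < N, X i s ∉ H g} = ⋂ i, ⋂ (_ : i < N), (X i ⁻¹' H g)ᶜ := by
      ext s
      simp
    rw [this]
    exact MeasurableSet.iInter fun i => MeasurableSet.iInter fun _ => (hX i (hH g)).compl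
  have hbad : P.real bad ≤ 1 / (2 * ω) := by
    refine le_trans ?_ (net_card_mul_exp_le hn hm hω hN)
    calc P.real bad ≤ ∑ g ∈ T, P.real {s | ∀ i < N, X i s ∉ H g} :=
          measureReal_biUnion_finset_le T _
      _ ≤ ∑ g ∈ T, Real.exp (-(N * (δ ^ (1 / κ) / 2))) := by
          refine Finset.sum_le_sum fun g hg => measureReal_forall_lt_notMem_le hX hind hmap (hH g)
            ?_ N
          obtain ⟨x, hx, hgx⟩ := hT1 g hg
          -- If `g x = -1`, symmetry of `K` supplies `-x`.
          rcases (abs_eq zero_le_one).1 hgx with h | h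
          · exact hc.le_measure_halfspace hκ hs (hsupp ▸ hx) g h hδ0 (by linarith)
          · exact hc.le_measure_halfspace hκ hs (x := -x) (hsupp ▸ hKs x hx) g (by simp [h]) hδ0
              (by linarith)
      _ = T.card * Real.exp (-(N * (δ ^ (1 / κ) / 2))) := by simp
      _ ≤ _ := by gcongr
  have hlow : ∀ s, (∀ i, X i s ∈ K) → s ∉ bad →
      (1 - 3 * δ) ^ n * volume.real K ≤ volume.real (randomPolytope X N s) := by
    intro s hsK hsb
    have hsm : (1 - 3 * δ) • K ⊆ randomPolytope X N s := by
      refine smul_subset_convexHull_of_net hKc (by linarith) (T := (T : Set _)) hT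
        ((Set.finite_Iio N).image _) ⟨_, 0, hN0, rfl⟩ (by rintro _ ⟨i, -, rfl⟩; exact hsK i) ?_
      intro g hg
      by_contra! hcon
      refine hsb (Set.mem_biUnion hg fun i hi hmem => ?_)
      exact absurd hmem (not_le.2 (hcon _ ⟨i, hi, rfl⟩))
    have hfin : volume (randomPolytope X N s) ≠ ⊤ :=
      ((measure_mono (hsub s hsK)).trans_lt hKc.measure_lt_top).ne
    refine le_trans (le_of_eq ?_) (measureReal_mono hsm hfin)
    rw [Measure.real, Measure.real, Measure.addHaar_smul_of_nonneg _ (by linarith),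
      finrank_euclideanSpace_fin, ENNReal.toReal_mul,
      ENNReal.toReal_ofReal (pow_nonneg (by linarith) _)]
  have hbern : 1 - 1 / (2 * ω) ≤ (1 - 3 * δ) ^ n := by
    have := one_add_mul_le_pow (a := -(3 * δ)) (by linarith) n
    rw [← sub_eq_add_neg] at this
    linarith
  have hmean : (1 - 3 * δ) ^ n * volume.real K * (1 - P.real bad) ≤
      ∫ s, volume.real (randomPolytope X N s) ∂P := by
    have hind' : ∫ s, badᶜ.indicator (fun _ => (1 - 3 * δ) ^ n * volume.real K) s ∂P =
        (1 - 3 * δ) ^ n * volume.real K * (1 - P.real bad) := by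
      rw [integral_indicator_const _ hbadm.compl, probReal_compl_eq_one_sub hbadm, smul_eq_mul,
        mul_comm]
    rw [← hind']
    refine integral_mono_ae ((integrable_const _).indicator hbadm.compl) hint ?_
    filter_upwards [hXK] with s hsK
    by_cases hsb : s ∈ bad
    · simp [hsb]
    · simpa [hsb] using hlow s hsK hsb
  rw [le_div_iff₀ hvol]
  refine le_trans ?_ hmean
  have e : 1 / ω = 2 * (1 / (2 * ω)) := by field_simp
  have hq : 0 < 1 / (2 * ω) := by positivity
  have : 1 - 1 / ω ≤ (1 - 3 * δ) ^ n * (1 - P.real bad) := by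
    calc 1 - 1 / ω ≤ (1 - 1 / (2 * ω)) * (1 - 1 / (2 * ω)) := by rw [e]; nlinarith
      _ ≤ (1 - 3 * δ) ^ n * (1 - P.real bad) :=
        mul_le_mul hbern (by linarith) (by linarith) (pow_nonneg (by linarith) _)
  nlinarith
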